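/- Let $K$ be a number field with ring of integers $\mathcal O_K$, and let $S$ be the set of its embeddings $\sigma$ into $\mathbb R$ or $\mathbb C$, where one embedding is chosen from each pair $\{\sigma,\bar\sigma\}$ of non-real complex conjugate embeddings. Let $K_S=\mathbb R^{r}\times\mathbb C^{s}$, with one factor for each $\sigma\in S$, where $r$ and $s$ are the numbers of real and complex $\sigma\in S$. View $\mathrm{SL}_2(\mathcal O_K)$ as a subgroup of $\mathrm{SL}_2(K_S)=\mathrm{SL}_2(\mathbb R)^r\times\mathrm{SL}_2(\mathbb C)^s$ through $\gamma\mapsto(\sigma(\gamma))_{\sigma\in S}$, and for $t\in\mathbb R$ put $$g_t=\left(\begin{pmatrix}e^{-t}&0\\0&e^{t}\end{pmatrix}\right)_{\sigma\in S}\in \mathrm{SL}_2(K_S).$$ Let $\mathbf x=(x^\sigma)_{\sigma\in S}\in K_S$. Then $\mathbf x$ is $K$-badly approximable, that is, there exists $c>0$ such that $$\max_{\sigma\in S}|\sigma(q)x^\sigma+\sigma(p)|\cdot\max_{\sigma\in S}|\sigma(q)|>c\qquad\text{for all }p,q\in\mathcal O_K\text{ with }q\neq0$$ (with the usual absolute values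 on $\mathbb R$ and $\mathbb C$), if and only if the trajectory $$\left\{\mathrm{SL}_2(\mathcal O_K)\left(\begin{pmatrix}1&x^\sigma\\0&1\end{pmatrix}\right)_{\sigma\in S}g_t \;:\; t\ge0\right\}$$ is bounded, i.e. relatively compact, in the quotient space $\mathrm{SL}_2(\mathcal O_K)\backslash\mathrm{SL}_2(K_S)$. -/

import Mathlib

open NumberField NumberField.mixedEmbedding Matrix

noncomputable section

namespace DaniNF

/-- The embedding `τ` of the ring of integers into `K_S = ℝ^r × ℂ^s` (the mixed space of `K`),
`τ(a) = (σ(a))_σ`, with one embedding `σ` for every infinite place. -/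
def tau (K : Type*) [Field K] [NumberField K] : 𝓞 K →+* mixedSpace K :=
  (mixedEmbedding K).comp (algebraMap (𝓞 K) K)

/-- `max_σ |x^σ|`, the maximum over the infinite places (a finite, non-empty set) of the ordinary
real or complex absolute values of the coordinates of `x`; nothing is squared at complex places. -/
def maxAbs {K : Type*} [Field K] [NumberField K] (x : mixedSpace K) : ℝ :=
  Finset.univ.sup' Finset.univ_nonempty (fun w : InfinitePlace K => normAtPlace w x)

/-- `x` is `K`-badly approximable. -/
def IsBadlyApproximable {K : Type*} [Field K] [NumberField K] (x : mixedSpace K) : Prop :=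
  ∃ c : ℝ, 0 < c ∧ ∀ p q : 𝓞 K, q ≠ 0 →
    c < maxAbs (tau K q * x + tau K p) * maxAbs (tau K q)

/-- `SL₂(K_S)`: as `K_S` is a product ring, this is the product over `σ` of the groups
`SL₂(ℝ)` or `SL₂(ℂ)`. It carries the topology of its matrix entries. -/
abbrev SL2KS (K : Type*) [Field K] [NumberField K] : Type _ :=
  SpecialLinearGroup (Fin 2) (mixedSpace K)

/-- `SL₂(𝓞 K)` as a subgroup of `SL₂(K_S)`, embedded entrywise by `τ`. -/
def arithmeticSubgroup (K : Type*) [Field K] [NumberField K] : Subgroup (SL2KS K) :=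
  (SpecialLinearGroup.map (n := Fin 2) (tau K)).range

/-- The space `SL₂(𝓞 K) \ SL₂(K_S)` of cosets `SL₂(𝓞 K) g`, with the quotient topology. -/
abbrev cosetSpace (K : Type*) [Field K] [NumberField K] : Type _ :=
  Quotient (QuotientGroup.rightRel (arithmeticSubgroup K))

/-- The coset `SL₂(𝓞 K) g`. -/
def coset {K : Type*} [Field K] [NumberField K] (g : SL2KS K) : cosetSpace K :=
  Quotient.mk _ g

/-- The element of `SL₂(K_S)` with component `(1, x^σ; 0, 1)` at every `σ`. -/
def upperUnipotent {K : Type*} [Field K] [NumberField K] (x : mixedSpace K) : SL2KS K :=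
  ⟨!![1, x; 0, 1], by simp⟩

/-- The element `g_t` of `SL₂(K_S)` with component `diag(e^{-t}, e^t)` at every `σ`. -/
def geodesicFlow (K : Type*) [Field K] [NumberField K] (t : ℝ) : SL2KS K :=
  ⟨!![algebraMap ℝ (mixedSpace K) (Real.exp (-t)), 0;
      0, algebraMap ℝ (mixedSpace K) (Real.exp t)], by
    rw [Matrix.det_fin_two_of, ← map_mul, ← Real.exp_add]; simp⟩

/-- The trajectory `{SL₂(𝓞 K) (1, x^σ; 0, 1)_σ g_t : t ≥ 0}`. -/
def trajectory {K : Type*} [Field K] [NumberField K] (x : mixedSpace K) : Set (cosetSpace K) :=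
  {y | ∃ t : ℝ, 0 ≤ t ∧ y = coset (upperUnipotent x * geodesicFlow K t)}

/-- A subset of a topological space is bounded if it is relatively compact. -/
def IsBoundedSubset {X : Type*} [TopologicalSpace X] (A : Set X) : Prop :=
  IsCompact (closure A)

end DaniNF

end

noncomputable section

namespace DaniNF

open MeasureTheory Module
open scoped Classical

variable {K : Type*} [Field K] [NumberField K]

/-! To `g` attach the lattice of rows `v g` with `v ∈ (𝓞 K)²`. Along the trajectory the row `(q, p)`
becomes `(e^{-t} q, e^t (q x + p))`, and the product of the norms of its two coordinates does not
depend on `t`. Balancing them by the choice of `t` shows that bad approximability is a uniform lower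
bound on nonzero lattice vectors for all `t ≥ 0` (`isBadlyApproximable_iff_isSeparated`).

Mahler's criterion turns this bound into relative compactness. If `g` has bounded entries, applying
`g⁻¹` bounds nonzero vectors below (`isSeparated_of_norm_lt`). Conversely, Minkowski's theorem gives
two independent bounded vectors in a separated lattice (`exists_det_ne_zero_norm_le`). They need not
form an `𝓞 K`-basis, but their coefficient matrix `M` has bounded determinant `d ≠ 0`. Only finitely
many `d`, and classes of `M` modulo `d`, occur. Hence `M = N γ` with `N` from a finite list and `γ ∈
SL₂(𝓞 K)`, and `γ g = N⁻¹ (M g)` is bounded (`exists_reduction`). -/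

theorem maxAbs_eq_norm (x : mixedSpace K) : maxAbs x = ‖x‖ :=
  (norm_eq_sup'_normAtPlace x).symm

theorem normAtPlace_le_norm (w : InfinitePlace K) (x : mixedSpace K) : normAtPlace w x ≤ ‖x‖ := by
  rw [norm_eq_sup'_normAtPlace]
  exact Finset.le_sup' (fun w => normAtPlace w x) (Finset.mem_univ w)

theorem norm_le_iff_normAtPlace {x : mixedSpace K} {r : ℝ} :
    ‖x‖ ≤ r ↔ ∀ w, normAtPlace w x ≤ r := by
  rw [norm_eq_sup'_normAtPlace, Finset.sup'_le_iff]; simp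

theorem norm_lt_iff_normAtPlace {x : mixedSpace K} {r : ℝ} :
    ‖x‖ < r ↔ ∀ w, normAtPlace w x < r := by
  rw [norm_eq_sup'_normAtPlace, Finset.sup'_lt_iff]; simp

theorem tau_apply (a : 𝓞 K) : tau K a = mixedEmbedding K (a : K) := rfl

theorem mem_convexBodyLT_iff {K : Type*} [Field K] {x : mixedSpace K} {f : InfinitePlace K → NNReal} :
    x ∈ convexBodyLT K f ↔ ∀ w, normAtPlace w x < f w := by
  simp only [Set.mem_prod, Set.mem_pi, Set.mem_univ, forall_true_left, mem_ball_zero_iff]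
  constructor
  · rintro ⟨h1, h2⟩ w
    rcases w.isReal_or_isComplex with hw | hw
    · rw [normAtPlace_apply_of_isReal hw]; exact h1 ⟨w, hw⟩
    · rw [normAtPlace_apply_of_isComplex hw]; exact h2 ⟨w, hw⟩
  · intro h
    exact ⟨fun w => by simpa [normAtPlace_apply_of_isReal w.2] using h w.1,
      fun w => by simpa [normAtPlace_apply_of_isComplex w.2] using h w.1⟩

/-- Every nonzero integer has an embedding of absolute value at least one. -/
theorem one_le_norm_tau {a : 𝓞 K} (ha : a ≠ 0) : 1 ≤ ‖tau K a‖ := by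
  by_contra! h
  let w₀ : InfinitePlace K := Classical.arbitrary _
  have hlt : ∀ w : InfinitePlace K, w (a : K) < 1 := fun w => by
    simpa [tau_apply] using (normAtPlace_le_norm w (tau K a)).trans_lt h
  exact absurd (InfinitePlace.one_le_of_lt_one (w := w₀) ha fun z _ => hlt z) (not_le.mpr (hlt w₀))

/-- The vector `v g` for a row vector `v` with entries in the ring of integers. -/
def rowMul (v : Fin 2 → 𝓞 K) (g : SL2KS K) : Fin 2 → mixedSpace K := (tau K ∘ v) ᵥ* g.1

theorem rowMul_apply (v : Fin 2 → 𝓞 K) (g : SL2KS K) (j : Fin 2) :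
    rowMul v g j = tau K (v 0) * g.1 0 j + tau K (v 1) * g.1 1 j := by
  simp [rowMul, Matrix.vecMul, dotProduct, Fin.sum_univ_two]

/-- The real determinant is the algebra norm of the determinant over `K_S`. Right multiplication by
`g` therefore preserves volume, which makes Minkowski's theorem uniform in `g`. -/
theorem det_vecMul_restrictScalars (g : SL2KS K) :
    LinearMap.det ((Matrix.vecMulLinear g.1).restrictScalars ℝ) = 1 := by
  rw [LinearMap.det_restrictScalars]
  have : Matrix.vecMulLinear g.1 = Matrix.toLin' g.1ᵀ := by
    refine LinearMap.ext fun v => ?_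
    rw [Matrix.toLin'_apply, Matrix.mulVec_transpose, Matrix.vecMulLinear_apply]
  rw [this, LinearMap.det_toLin', Matrix.det_transpose, g.2, map_one]

instance : SecondCountableTopology (mixedSpace K) := inferInstanceAs
  (SecondCountableTopology (({w : InfinitePlace K // w.IsReal} → ℝ) ×
    ({w : InfinitePlace K // w.IsComplex} → ℂ)))

instance : BorelSpace (mixedSpace K) := inferInstanceAs
  (BorelSpace (({w : InfinitePlace K // w.IsReal} → ℝ) × ({w : InfinitePlace K // w.IsComplex} → ℂ)))

instance : BorelSpace (Fin 2 → mixedSpace K) := Pi.borelSpace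

instance : Measure.IsAddHaarMeasure (volume : Measure (Fin 2 → mixedSpace K)) :=
  Measure.pi.isAddHaarMeasure _

/-! ### Geometry of numbers. -/

/-- Minkowski's theorem for the lattice `(𝓞 K)² g`, uniformly in `g`. -/
theorem exists_rowMul_lt (K : Type*) [Field K] [NumberField K] {η : ℝ} (hη : 0 < η) :
    ∃ T : ℝ, 0 < T ∧ ∀ g : SL2KS K, ∃ v : Fin 2 → 𝓞 K, v ≠ 0 ∧
      ‖rowMul v g 0‖ < η ∧ ‖rowMul v g 1‖ < T := by
  classical
  let b : Basis ((_ : Fin 2) × (Free.ChooseBasisIndex ℤ (𝓞 K))) ℝ (Fin 2 → mixedSpace K) :=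
    Pi.basis fun _ => latticeBasis K
  let V : ENNReal := volume (ZSpan.fundamentalDomain b) * 2 ^ finrank ℝ (Fin 2 → mixedSpace K)
  have hV : V ≠ ⊤ := ENNReal.mul_ne_top
    (ZSpan.fundamentalDomain_isBounded b).measure_lt_top.ne (by simp)
  let f₀ : InfinitePlace K → NNReal := fun _ => ⟨η, hη.le⟩
  have hf₀ : volume (convexBodyLT K f₀) ≠ 0 := by
    rw [convexBodyLT_volume]
    have h1 := convexBodyLTFactor_ne_zero K
    have h2 : ∏ w : InfinitePlace K, f₀ w ^ w.mult ≠ 0 :=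
      Finset.prod_ne_zero_iff.mpr fun w _ => pow_ne_zero _ (ne_of_gt hη)
    exact_mod_cast mul_ne_zero h1 h2
  have hf₀' : volume (convexBodyLT K f₀) ≠ ⊤ := by
    rw [convexBodyLT_volume]; exact ENNReal.mul_ne_top ENNReal.coe_ne_top ENNReal.coe_ne_top
  -- The second factor is enlarged at one place until the box exceeds the Minkowski threshold `V`;
  -- this choice precedes `g`.
  obtain ⟨f₁, -, hf₁⟩ := adjust_f (f := fun _ => 1) (w₁ := Classical.arbitrary (InfinitePlace K)) K
    ((V / volume (convexBodyLT K f₀)).toNNReal + 1) (by simp)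
  have hvol : V < volume (convexBodyLT K f₀) * volume (convexBodyLT K f₁) := by
    have hlt : V / volume (convexBodyLT K f₀) < volume (convexBodyLT K f₁) := by
      have hne : V / volume (convexBodyLT K f₀) ≠ ⊤ := ENNReal.div_ne_top hV hf₀
      rw [convexBodyLT_volume (f := f₁), hf₁]
      rw [← ENNReal.coe_toNNReal hne]
      have := one_le_convexBodyLTFactor K
      norm_cast
      calc _ < (V / volume (convexBodyLT K f₀)).toNNReal + 1 := lt_add_one _
        _ ≤ _ := le_mul_of_one_le_left zero_le this
    rw [mul_comm]
    exact (ENNReal.div_lt_iff (Or.inl hf₀) (Or.inl hf₀')).mp hlt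
  obtain ⟨T, hT⟩ := Finite.exists_le f₁
  refine ⟨T + 1, by positivity, fun g => ?_⟩
  let φ := (Matrix.vecMulLinear g.1).restrictScalars ℝ
  have hφ : LinearMap.det φ = 1 := det_vecMul_restrictScalars g
  let box : Fin 2 → Set (mixedSpace K) := ![convexBodyLT K f₀, convexBodyLT K f₁]
  let s : Set (Fin 2 → mixedSpace K) := φ ⁻¹' (Set.univ.pi box)
  have hs : volume s = volume (convexBodyLT K f₀) * volume (convexBodyLT K f₁) := by
    rw [Measure.addHaar_preimage_linearMap _ (by rw [hφ]; exact one_ne_zero), hφ, volume_pi_pi]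
    simp [box, Fin.prod_univ_two]
  have hsymm : ∀ x ∈ s, -x ∈ s := by
    intro x hx i hi
    have := hx i hi
    rw [map_neg]
    fin_cases i
    · exact convexBodyLT_neg_mem K f₀ _ this
    · exact convexBodyLT_neg_mem K f₁ _ this
  have hconv : Convex ℝ s := by
    refine Convex.linear_preimage (convex_pi fun i _ => ?_) φ
    fin_cases i
    · exact convexBodyLT_convex K f₀
    · exact convexBodyLT_convex K f₁
  have : Countable (Submodule.span ℤ (Set.range b)).toAddSubgroup :=
    inferInstanceAs (Countable (Submodule.span ℤ (Set.range b)))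
  obtain ⟨⟨x, hxmem⟩, hx0, hxs⟩ := exists_ne_zero_mem_lattice_of_measure_mul_two_pow_lt_measure
    (ZSpan.isAddFundamentalDomain' b volume) hsymm hconv (by rw [hs]; exact hvol)
  have hrange : ∃ v : Fin 2 → 𝓞 K, tau K ∘ v = x := by
    refine Submodule.span_induction (p := fun x _ => ∃ v : Fin 2 → 𝓞 K, tau K ∘ v = x)
      ?_ ?_ ?_ ?_ hxmem
    · rintro _ ⟨⟨i, j⟩, rfl⟩
      refine ⟨Pi.single i (RingOfIntegers.basis K j), ?_⟩
      ext1 k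
      simp only [b, Pi.basis_apply, latticeBasis_apply, integralBasis_apply]
      by_cases hk : k = i
      · subst hk; simp [tau_apply]
      · simp [hk]
    · exact ⟨0, by ext1; simp⟩
    · rintro _ _ _ _ ⟨v, rfl⟩ ⟨w, rfl⟩
      exact ⟨v + w, by ext1; simp⟩
    · rintro n _ _ ⟨v, rfl⟩
      exact ⟨n • v, by ext1; simp⟩
  obtain ⟨v, rfl⟩ := hrange
  refine ⟨v, ?_, ?_, ?_⟩
  · rintro rfl
    exact hx0 (Subtype.ext (by ext1; simp))
  · rw [norm_lt_iff_normAtPlace]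
    exact mem_convexBodyLT_iff.mp (hxs 0 trivial)
  · rw [norm_lt_iff_normAtPlace]
    intro w
    have h1 := mem_convexBodyLT_iff.mp (hxs 1 trivial) w
    have h2 : (f₁ w : ℝ) ≤ T := by exact_mod_cast hT w
    exact h1.trans_le (h2.trans (by linarith))

/-- Nonzero integers that are small at all places but one. -/
theorem exists_ne_zero_lt_away (K : Type*) [Field K] [NumberField K] {η : ℝ} (hη : 0 < η) :
    ∃ L : ℝ, 0 < L ∧ ∀ w₀ : InfinitePlace K, ∃ a : 𝓞 K, a ≠ 0 ∧
      normAtPlace w₀ (tau K a) < L ∧ ∀ w, w ≠ w₀ → normAtPlace w (tau K a) < η := by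
  classical
  have key : ∀ w₀ : InfinitePlace K, ∃ L : ℝ, ∃ a : 𝓞 K, a ≠ 0 ∧
      normAtPlace w₀ (tau K a) < L ∧ ∀ w, w ≠ w₀ → normAtPlace w (tau K a) < η := by
    intro w₀
    obtain ⟨f, hf, hprod⟩ := adjust_f (f := fun _ => ⟨η, hη.le⟩) (w₁ := w₀) K
      ((minkowskiBound K ↑1).toNNReal + 1) (fun w _ => ne_of_gt hη)
    obtain ⟨a, ha, hlt⟩ := exists_ne_zero_mem_ringOfIntegers_lt (f := f) K (by
      rw [convexBodyLT_volume, hprod]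
      have := one_le_convexBodyLTFactor K
      conv_lhs => rw [← ENNReal.coe_toNNReal (minkowskiBound_lt_top K ↑1).ne]
      norm_cast
      calc _ < (minkowskiBound K ↑1).toNNReal + 1 := lt_add_one _
        _ ≤ _ := le_mul_of_one_le_left zero_le this)
    refine ⟨f w₀, a, ha, ?_, fun w hw => ?_⟩
    · rw [tau_apply, normAtPlace_apply]; exact hlt w₀
    · rw [tau_apply, normAtPlace_apply]
      have := hlt w
      rw [hf w hw] at this
      exact this
  choose L a ha h1 h2 using key
  obtain ⟨M, hM⟩ := Finite.exists_le L
  exact ⟨max M 1, by positivity, fun w₀ =>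
    ⟨a w₀, ha w₀, (h1 w₀).trans_le ((hM w₀).trans (le_max_left _ _)), h2 w₀⟩⟩

/-! ### Independent bounded vectors in separated lattices. -/

/-- The lattice `(𝓞 K)² g` has no nonzero vector of norm less than `ε`. -/
def IsSeparated (ε : ℝ) (g : SL2KS K) : Prop :=
  ∀ v : Fin 2 → 𝓞 K, v ≠ 0 → ε ≤ ‖rowMul v g‖

theorem rowMul_smul (a : 𝓞 K) (v : Fin 2 → 𝓞 K) (g : SL2KS K) (j : Fin 2) :
    rowMul (a • v) g j = tau K a * rowMul v g j := by
  simp only [rowMul_apply, Pi.smul_apply, smul_eq_mul, map_mul]; ring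

theorem rowMul_mul (v : Fin 2 → 𝓞 K) (g h : SL2KS K) : rowMul v (g * h) = rowMul v g ᵥ* h.1 := by
  simp [rowMul, Matrix.vecMul_vecMul]

theorem norm_pi_two_le {E : Type*} [SeminormedAddCommGroup E] {w : Fin 2 → E} {r : ℝ}
    (h0 : ‖w 0‖ ≤ r) (h1 : ‖w 1‖ ≤ r) : ‖w‖ ≤ r := by
  refine (pi_norm_le_iff_of_nonempty _).mpr fun i => ?_
  fin_cases i
  · exact h0
  · exact h1

/-- In a separated lattice, bounded nonzero vectors are bounded below at every place. -/
theorem exists_le_normAtPlace_rowMul (K : Type*) [Field K] [NumberField K] {ε R : ℝ} (hε : 0 < ε)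
    (hR : 0 < R) : ∃ δ : ℝ, 0 < δ ∧ ∀ g : SL2KS K, IsSeparated ε g → ∀ v : Fin 2 → 𝓞 K, v ≠ 0 →
      ‖rowMul v g‖ ≤ R → ∀ w : InfinitePlace K,
        δ ≤ max (normAtPlace w (rowMul v g 0)) (normAtPlace w (rowMul v g 1)) := by
  obtain ⟨L, hL, hL'⟩ := exists_ne_zero_lt_away K (η := ε / (2 * R)) (by positivity)
  -- If `v g` were smaller than `ε / (2 * L)` at `w₀`, an integer `a` of size below `L` at `w₀` and
  -- below `ε / (2 * R)` elsewhere would make `a • v` too short.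
  refine ⟨ε / (2 * L), by positivity, fun g hg v hv hvR w₀ => ?_⟩
  by_contra! hlt
  obtain ⟨a, ha, ha₀, ha'⟩ := hL' w₀
  have hj : ∀ j, ‖rowMul (a • v) g j‖ ≤ ε / 2 := by
    intro j
    rw [rowMul_smul, norm_le_iff_normAtPlace]
    intro w
    rw [map_mul]
    by_cases hw : w = w₀
    · subst hw
      have : normAtPlace w (rowMul v g j) ≤ ε / (2 * L) := by
        have := max_lt_iff.mp hlt
        fin_cases j
        · exact this.1.le
        · exact this.2.le
      calc _ ≤ L * (ε / (2 * L)) := mul_le_mul ha₀.le this (normAtPlace_nonneg _ _) hL.le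
        _ = ε / 2 := by field_simp
    · have : normAtPlace w (rowMul v g j) ≤ R :=
        (normAtPlace_le_norm _ _).trans ((norm_le_pi_norm _ j).trans hvR)
      calc _ ≤ ε / (2 * R) * R :=
            mul_le_mul (ha' w hw).le this (normAtPlace_nonneg _ _) (by positivity)
        _ = ε / 2 := by field_simp
  have := hg (a • v) (smul_ne_zero ha hv)
  have := norm_pi_two_le (hj 0) (hj 1)
  linarith

theorem exists_bezout_of_le_max {F : Type*} [NormedField F] {δ : ℝ} (hδ : 0 < δ) {a b : F}
    (h : δ ≤ max ‖a‖ ‖b‖) : ∃ u v : F, a * u + b * v = 1 ∧ ‖u‖ ≤ δ⁻¹ ∧ ‖v‖ ≤ δ⁻¹ := by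
  rcases le_max_iff.mp h with h | h
  · refine ⟨a⁻¹, 0, ?_, ?_, ?_⟩
    · simp [mul_inv_cancel₀ (norm_pos_iff.mp (hδ.trans_le h))]
    · rw [norm_inv]; gcongr
    · simp [hδ.le]
  · refine ⟨0, b⁻¹, ?_, ?_, ?_⟩
    · simp [mul_inv_cancel₀ (norm_pos_iff.mp (hδ.trans_le h))]
    · simp [hδ.le]
    · rw [norm_inv]; gcongr

/-- `K_S` has zero divisors, so the coordinate to invert is chosen separately at each place. -/
theorem exists_mixedSpace_bezout {δ : ℝ} (hδ : 0 < δ) {a b : mixedSpace K}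
    (h : ∀ w, δ ≤ max (normAtPlace w a) (normAtPlace w b)) :
    ∃ u v : mixedSpace K, a * u + b * v = 1 ∧ ‖u‖ ≤ δ⁻¹ ∧ ‖v‖ ≤ δ⁻¹ := by
  have hr : ∀ w : {w : InfinitePlace K // w.IsReal}, δ ≤ max ‖a.1 w‖ ‖b.1 w‖ := fun w => by
    simpa only [normAtPlace_apply_of_isReal w.2] using h w.1
  have hc : ∀ w : {w : InfinitePlace K // w.IsComplex}, δ ≤ max ‖a.2 w‖ ‖b.2 w‖ := fun w => by
    simpa only [normAtPlace_apply_of_isComplex w.2] using h w.1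
  choose ur vr hr1 hr2 hr3 using fun w => exists_bezout_of_le_max hδ (hr w)
  choose uc vc hc1 hc2 hc3 using fun w => exists_bezout_of_le_max hδ (hc w)
  have hδ' : 0 ≤ δ⁻¹ := by positivity
  refine ⟨(ur, uc), (vr, vc), Prod.ext (funext hr1) (funext hc1), ?_, ?_⟩
  · exact norm_prod_le_iff.mpr ⟨(pi_norm_le_iff_of_nonneg hδ').mpr hr2,
      (pi_norm_le_iff_of_nonneg hδ').mpr hc2⟩
  · exact norm_prod_le_iff.mpr ⟨(pi_norm_le_iff_of_nonneg hδ').mpr hr3,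
      (pi_norm_le_iff_of_nonneg hδ').mpr hc3⟩

/-- A separated lattice `(𝓞 K)² g` contains two independent vectors of bounded norm. -/
theorem exists_det_ne_zero_norm_le (K : Type*) [Field K] [NumberField K] {ε : ℝ} (hε : 0 < ε) :
    ∃ R : ℝ, ∀ g : SL2KS K, IsSeparated ε g → ∃ M : Matrix (Fin 2) (Fin 2) (𝓞 K), M.det ≠ 0 ∧
      ∀ i, ‖rowMul (M i) g‖ ≤ R := by
  obtain ⟨T, hT, hT'⟩ := exists_rowMul_lt K one_pos
  set R := max 1 T
  have hR : 0 < R := by positivity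
  obtain ⟨δ, hδ, hδ'⟩ := exists_le_normAtPlace_rowMul K hε hR
  obtain ⟨U, hU, hU'⟩ := exists_rowMul_lt K (η := ε / R) (by positivity)
  refine ⟨max R (ε + U * δ⁻¹), fun g hg => ?_⟩
  obtain ⟨v, hv, hv0, hv1⟩ := hT' g
  have hvR : ‖rowMul v g‖ ≤ R := norm_pi_two_le (hv0.le.trans (le_max_left _ _))
    (hv1.le.trans (le_max_right _ _))
  obtain ⟨p, q, hpq, hp, hq⟩ := exists_mixedSpace_bezout hδ (hδ' g hg v hv hvR)
  set a := rowMul v g 0 with ha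
  set b := rowMul v g 1 with hb
  have haR : ‖a‖ ≤ R := (norm_le_pi_norm _ 0).trans hvR
  have hbR : ‖b‖ ≤ R := (norm_le_pi_norm _ 1).trans hvR
  -- `A` sends the row `(a, b)` to `(1, 0)`. The second coordinate `y₁` of `u g A` is then the
  -- determinant of the rows `v g` and `u g`, and its vanishing means dependence.
  let A : SL2KS K := ⟨!![p, -b; q, a], by rw [Matrix.det_fin_two_of]; linear_combination hpq⟩
  obtain ⟨u, hu, hu0, hu1⟩ := hU' (g * A)
  set y₀ := rowMul u (g * A) 0 with hy₀
  set y₁ := rowMul u (g * A) 1 with hy₁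
  have e0 : y₀ = rowMul u g 0 * p + rowMul u g 1 * q := by
    rw [hy₀, rowMul_mul]; simp [A, Matrix.vecMul, dotProduct, Fin.sum_univ_two]
  have e1 : y₁ = -(rowMul u g 0 * b) + rowMul u g 1 * a := by
    rw [hy₁, rowMul_mul]; simp [A, Matrix.vecMul, dotProduct, Fin.sum_univ_two]
  have f0 : rowMul u g 0 = y₀ * a - y₁ * q := by
    rw [e0, e1]; linear_combination (-rowMul u g 0) * hpq
  have f1 : rowMul u g 1 = y₀ * b + y₁ * p := by
    rw [e0, e1]; linear_combination (-rowMul u g 1) * hpq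
  have hya : ∀ c : mixedSpace K, ‖c‖ ≤ R → ‖y₀ * c‖ < ε := fun c hc =>
    calc ‖y₀ * c‖ ≤ ‖y₀‖ * ‖c‖ := norm_mul_le _ _
      _ ≤ ‖y₀‖ * R := by gcongr
      _ < ε / R * R := by gcongr
      _ = ε := by field_simp
  have hyq : ∀ c : mixedSpace K, ‖c‖ ≤ δ⁻¹ → ‖y₁ * c‖ ≤ U * δ⁻¹ := fun c hc =>
    (norm_mul_le _ _).trans (mul_le_mul hu1.le hc (norm_nonneg _) hU.le)
  -- Otherwise `u g = y₀ (a, b)`, and `‖y₀‖ < ε / R` contradicts separation.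
  have hy₁0 : y₁ ≠ 0 := by
    intro h0
    rw [h0, zero_mul, sub_zero] at f0
    rw [h0, zero_mul, add_zero] at f1
    have : ‖rowMul u g‖ < ε := (pi_norm_lt_iff hε).mpr fun i => by
      fin_cases i
      · exact f0 ▸ hya a haR
      · exact f1 ▸ hya b hbR
    exact absurd (hg u hu) (not_le.mpr this)
  refine ⟨!![v 0, v 1; u 0, u 1], ?_, ?_⟩
  · intro hdet
    apply hy₁0
    have hg1 : g.1 0 0 * g.1 1 1 - g.1 0 1 * g.1 1 0 = 1 := by
      rw [← Matrix.det_fin_two]; exact g.2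
    have hd : tau K (v 0) * tau K (u 1) - tau K (v 1) * tau K (u 0) = 0 := by
      rw [Matrix.det_fin_two_of] at hdet
      simpa using congrArg (tau K) hdet
    rw [e1, ha, hb]
    simp only [rowMul_apply]
    linear_combination (g.1 0 0 * g.1 1 1 - g.1 0 1 * g.1 1 0) * hd
  · intro i
    fin_cases i
    · have : (!![v 0, v 1; u 0, u 1] : Matrix (Fin 2) (Fin 2) (𝓞 K)) 0 = v := by
        ext j; fin_cases j <;> rfl
      exact (this ▸ hvR).trans (le_max_left _ _)
    · have : (!![v 0, v 1; u 0, u 1] : Matrix (Fin 2) (Fin 2) (𝓞 K)) 1 = u := by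
        ext j; fin_cases j <;> rfl
      refine le_trans ?_ (le_max_right _ _)
      show ‖rowMul ((!![v 0, v 1; u 0, u 1] : Matrix (Fin 2) (Fin 2) (𝓞 K)) 1) g‖ ≤ _
      rw [this]
      refine norm_pi_two_le ?_ ?_
      · rw [f0]
        exact (norm_sub_le _ _).trans (add_le_add (hya a haR).le (hyq q hq))
      · rw [f1]
        exact (norm_add_le _ _).trans (add_le_add (hya b hbR).le (hyq p hp))

/-! ### Reduction modulo `SL₂(𝓞 K)`. -/

theorem finite_norm_tau_le (K : Type*) [Field K] [NumberField K] (B : ℝ) :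
    {a : 𝓞 K | ‖tau K a‖ ≤ B}.Finite := by
  have h := Embeddings.finite_of_norm_le K ℂ B
  refine Set.Finite.of_finite_image (f := fun a : 𝓞 K => (a : K)) (h.subset ?_)
    RingOfIntegers.coe_injective.injOn
  rintro _ ⟨a, ha, rfl⟩
  refine ⟨a.2, fun φ => ?_⟩
  have := (normAtPlace_le_norm (InfinitePlace.mk φ) (tau K a)).trans ha
  rwa [tau_apply, normAtPlace_apply, InfinitePlace.apply] at this

/-- Matrices of the same determinant `d` that are congruent modulo `d` differ by right
multiplication by an element of `SL₂`. -/
theorem exists_eq_mul_of_congr {R : Type*} [CommRing R] [IsDomain R] {d : R} (hd : d ≠ 0)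
    {M N : Matrix (Fin 2) (Fin 2) R} (hM : M.det = d) (hN : N.det = d)
    (h : ∀ i j, d ∣ M i j - N i j) : ∃ γ : SpecialLinearGroup (Fin 2) R, M = N * γ.1 := by
  choose X hX using h
  have hX' : M = N + d • Matrix.of X := by
    ext i j; simp [← hX]
  -- Since `N * N.adjugate` is the scalar `d`, the difference `d X` is a left multiple of `N` over
  -- `R`.
  have key : M = N * (1 + N.adjugate * Matrix.of X) := by
    rw [mul_add, mul_one, ← mul_assoc, Matrix.mul_adjugate, hN, hX', Matrix.smul_mul, one_mul]
  refine ⟨⟨1 + N.adjugate * Matrix.of X, ?_⟩, key⟩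
  have := congrArg Matrix.det key
  rw [Matrix.det_mul, hM, hN] at this
  exact mul_left_cancel₀ hd (by rw [← this, mul_one])

/-- Uniform reduction of `g` by `SL₂(𝓞 K)`, given two bounded independent vectors of `(𝓞 K)² g`. -/
theorem exists_reduction (K : Type*) [Field K] [NumberField K] (R : ℝ) :
    ∃ C : ℝ, ∀ (M : Matrix (Fin 2) (Fin 2) (𝓞 K)) (g : SL2KS K), M.det ≠ 0 →
      (∀ i j, ‖(M.map (tau K) * g.1) i j‖ ≤ R) → ∃ γ : SpecialLinearGroup (Fin 2) (𝓞 K),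
        ∀ i j, ‖(SpecialLinearGroup.map (tau K) γ * g).1 i j‖ ≤ C := by
  have key : ∀ d : 𝓞 K, ∃ C : ℝ, ∀ (M : Matrix (Fin 2) (Fin 2) (𝓞 K)) (g : SL2KS K), d ≠ 0 →
      M.det = d → (∀ i j, ‖(M.map (tau K) * g.1) i j‖ ≤ R) →
      ∃ γ : SpecialLinearGroup (Fin 2) (𝓞 K),
        ∀ i j, ‖(SpecialLinearGroup.map (tau K) γ * g).1 i j‖ ≤ C := by
    intro d
    by_cases hd : d = 0
    · exact ⟨0, fun _ _ h => absurd hd h⟩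
    have : Finite (𝓞 K ⧸ Ideal.span {d}) :=
      Ideal.finiteQuotientOfFreeOfNeBot _ (by simpa using hd)
    let red : Matrix (Fin 2) (Fin 2) (𝓞 K) → (Fin 2 → Fin 2 → 𝓞 K ⧸ Ideal.span {d}) :=
      fun M i j => Ideal.Quotient.mk _ (M i j)
    have cls : ∀ c, ∃ C : ℝ, ∀ (M : Matrix (Fin 2) (Fin 2) (𝓞 K)) (g : SL2KS K), red M = c →
        M.det = d → (∀ i j, ‖(M.map (tau K) * g.1) i j‖ ≤ R) →
        ∃ γ : SpecialLinearGroup (Fin 2) (𝓞 K),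
          ∀ i j, ‖(SpecialLinearGroup.map (tau K) γ * g).1 i j‖ ≤ C := by
      intro c
      -- A class without a matrix of determinant `d` imposes no condition; otherwise one
      -- representative `N` serves the whole class.
      by_cases hc : ∃ N, red N = c ∧ N.det = d
      swap
      · exact ⟨0, fun M _ h1 h2 => absurd ⟨M, h1, h2⟩ hc⟩
      obtain ⟨N, hNc, hNd⟩ := hc
      let e : mixedSpace K := mixedEmbedding K ((d : K)⁻¹)
      have he : e * tau K d = 1 := by
        rw [tau_apply, ← map_mul, inv_mul_cancel₀ (RingOfIntegers.coe_ne_zero_iff.mpr hd), map_one]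
      let A : Matrix (Fin 2) (Fin 2) (mixedSpace K) := e • N.adjugate.map (tau K)
      have hA : A * N.map (tau K) = 1 := by
        rw [Matrix.smul_mul, ← Matrix.map_mul, Matrix.adjugate_mul, hNd]
        refine Matrix.ext fun i j => ?_
        by_cases hij : i = j
        · subst hij; simpa using he
        · simp [hij]
      refine ⟨(∑ i, ∑ k, ‖A i k‖) * R, fun M g hMc hMd hMg => ?_⟩
      obtain ⟨γ, hγ⟩ := exists_eq_mul_of_congr hd hMd hNd fun i j => by
        rw [← Ideal.mem_span_singleton, ← Ideal.Quotient.eq]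
        exact congrFun (congrFun (hMc.trans hNc.symm) i) j
      refine ⟨γ, fun i j => ?_⟩
      have hR : 0 ≤ R := (norm_nonneg _).trans (hMg 0 0)
      have e1 : (SpecialLinearGroup.map (tau K) γ * g).1 = A * (M.map (tau K) * g.1) := by
        rw [hγ, Matrix.map_mul, mul_assoc, ← mul_assoc A, hA, one_mul]
        rfl
      rw [e1, Matrix.mul_apply]
      calc _ ≤ ∑ k, ‖A i k * (M.map (tau K) * g.1) k j‖ := norm_sum_le _ _
        _ ≤ ∑ k, ‖A i k‖ * R := Finset.sum_le_sum fun k _ =>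
            (norm_mul_le _ _).trans (mul_le_mul_of_nonneg_left (hMg k j) (norm_nonneg _))
        _ = (∑ k, ‖A i k‖) * R := (Finset.sum_mul _ _ _).symm
        _ ≤ _ := by
            refine mul_le_mul_of_nonneg_right ?_ hR
            exact Finset.single_le_sum (f := fun i => ∑ k, ‖A i k‖)
              (fun i _ => Finset.sum_nonneg fun k _ => norm_nonneg _) (Finset.mem_univ i)
    choose C hC using cls
    obtain ⟨B, hB⟩ := Finite.exists_le C
    refine ⟨B, fun M g _ hMd hMg => ?_⟩
    obtain ⟨γ, hγ⟩ := hC (red M) M g rfl hMd hMg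
    exact ⟨γ, fun i j => (hγ i j).trans (hB _)⟩
  choose C hC using key
  -- As `g` has determinant one, `τ (det M) = det (M g)` has norm at most `2 R²`, leaving finitely
  -- many determinants.
  obtain ⟨B, hB⟩ := ((finite_norm_tau_le K (R * R + R * R)).image C).bddAbove
  refine ⟨B, fun M g hM hMg => ?_⟩
  obtain ⟨γ, hγ⟩ := hC M.det M g hM rfl hMg
  refine ⟨γ, fun i j => (hγ i j).trans (hB ⟨_, ?_, rfl⟩)⟩
  have hR : 0 ≤ R := (norm_nonneg _).trans (hMg 0 0)
  have hdet : tau K M.det = (M.map (tau K) * g.1).det := by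
    rw [Matrix.det_mul, g.2, mul_one, RingHom.map_det]; rfl
  rw [Set.mem_ofPred_eq, hdet, Matrix.det_fin_two]
  refine (norm_sub_le _ _).trans (add_le_add ?_ ?_)
  · exact (norm_mul_le _ _).trans (mul_le_mul (hMg _ _) (hMg _ _) (norm_nonneg _) hR)
  · exact (norm_mul_le _ _).trans (mul_le_mul (hMg _ _) (hMg _ _) (norm_nonneg _) hR)

/-- Reduction theory for separated lattices. -/
theorem IsSeparated.exists_reduction (K : Type*) [Field K] [NumberField K] {ε : ℝ} (hε : 0 < ε) :
    ∃ C : ℝ, ∀ g : SL2KS K, IsSeparated ε g → ∃ γ : SpecialLinearGroup (Fin 2) (𝓞 K),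
        ∀ i j, ‖(SpecialLinearGroup.map (tau K) γ * g).1 i j‖ ≤ C := by
  obtain ⟨R, hR⟩ := exists_det_ne_zero_norm_le K hε
  obtain ⟨C, hC⟩ := DaniNF.exists_reduction K R
  refine ⟨C, fun g hg => ?_⟩
  obtain ⟨M, hM, hMR⟩ := hR g hg
  exact hC M g hM fun i j => (norm_le_pi_norm (rowMul (M i) g) j).trans (hMR i)

/-! ### Mahler's compactness criterion. -/

theorem continuous_coset : Continuous (coset : SL2KS K → cosetSpace K) := continuous_quotient_mk'

theorem isOpenMap_coset : IsOpenMap (coset : SL2KS K → cosetSpace K) :=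
  isOpenMap_quotient_mk'_mul (Γ := arithmeticSubgroup K) (T := SL2KS K)

theorem coset_eq_iff {g h : SL2KS K} : coset g = coset h ↔
    ∃ γ : SpecialLinearGroup (Fin 2) (𝓞 K), h = SpecialLinearGroup.map (tau K) γ * g := by
  rw [coset, coset, Quotient.eq, QuotientGroup.rightRel_apply]
  constructor
  · rintro ⟨γ, hγ⟩
    exact ⟨γ, by rw [hγ, inv_mul_cancel_right]⟩
  · rintro ⟨γ, rfl⟩
    exact ⟨γ, by rw [mul_inv_cancel_right]⟩

/-- `SL₂(𝓞 K)` permutes the nonzero integer rows, so separation is a property of the coset. -/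
theorem IsSeparated.of_coset_eq {ε : ℝ} {g h : SL2KS K} (hg : IsSeparated ε g)
    (hgh : coset g = coset h) : IsSeparated ε h := by
  obtain ⟨γ, rfl⟩ := coset_eq_iff.mp hgh
  intro v hv
  have e : rowMul v (SpecialLinearGroup.map (tau K) γ * g) = rowMul (v ᵥ* γ.1) g := by
    rw [rowMul_mul]
    simp only [rowMul]
    congr 1
    exact (funext (RingHom.map_vecMul (tau K) γ.1 v)).symm
  rw [e]
  refine hg _ fun h0 => hv ?_
  have : (v ᵥ* γ.1) ᵥ* γ.1.adjugate = v := by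
    rw [Matrix.vecMul_vecMul, Matrix.mul_adjugate, γ.2, one_smul, Matrix.vecMul_one]
  rw [← this, h0, Matrix.zero_vecMul]

theorem continuous_entry (i j : Fin 2) : Continuous fun g : SL2KS K => g.1 i j :=
  SpecialLinearGroup.isClosedEmbedding_val.continuous.matrix_elem i j

theorem continuous_rowMul (v : Fin 2 → 𝓞 K) : Continuous (rowMul v : SL2KS K → _) := by
  refine continuous_pi fun j => ?_
  simp only [rowMul_apply]
  exact (continuous_const.mul (continuous_entry 0 j)).add
    (continuous_const.mul (continuous_entry 1 j))

/-- The cosets of `ε`-separated lattices form a closed set. -/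
theorem isClosed_coset_isSeparated (ε : ℝ) :
    IsClosed (coset '' {g : SL2KS K | IsSeparated ε g}) := by
  refine (isQuotientMap_quotient_mk'
    (s := QuotientGroup.rightRel (arithmeticSubgroup K))).isClosed_preimage.mp ?_
  have : (coset : SL2KS K → cosetSpace K) ⁻¹' (coset '' {g : SL2KS K | IsSeparated ε g})
      = {g | IsSeparated ε g} :=
    Set.Subset.antisymm (fun g ⟨h, hh, hgh⟩ => IsSeparated.of_coset_eq hh hgh)
      fun g hg => ⟨g, hg, rfl⟩
  change IsClosed ((coset : SL2KS K → cosetSpace K) ⁻¹' _)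
  rw [this]
  simp only [IsSeparated, Set.ofPred_forall]
  exact isClosed_iInter fun v => isClosed_iInter fun _ =>
    isClosed_le continuous_const (continuous_rowMul v).norm

/-- Mahler's criterion: the cosets of `ε`-separated lattices form a compact set. -/
theorem isCompact_coset_isSeparated {ε : ℝ} (hε : 0 < ε) :
    IsCompact (coset '' {g : SL2KS K | IsSeparated ε g}) := by
  obtain ⟨C, hC⟩ := IsSeparated.exists_reduction K hε
  have hD : IsCompact {g : SL2KS K | ∀ i j, ‖g.1 i j‖ ≤ C} := by
    have h1 : IsCompact (Set.univ.pi fun _ : Fin 2 => Set.univ.pi fun _ : Fin 2 =>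
        Metric.closedBall (0 : mixedSpace K) C) :=
      isCompact_univ_pi fun _ => isCompact_univ_pi fun _ => isCompact_closedBall _ _
    have h2 := (SpecialLinearGroup.isClosedEmbedding_val (n := Fin 2)
      (R := mixedSpace K)).isCompact_preimage h1
    have e : {g : SL2KS K | ∀ i j, ‖g.1 i j‖ ≤ C} = Subtype.val ⁻¹' (Set.univ.pi fun _ : Fin 2 =>
        Set.univ.pi fun _ : Fin 2 => Metric.closedBall (0 : mixedSpace K) C) :=
      Set.ext fun g => ⟨fun h i _ j _ => mem_closedBall_zero_iff.mpr (h i j),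
        fun h i j => mem_closedBall_zero_iff.mp (h i trivial j trivial)⟩
    rw [e]
    exact h2
  refine (hD.image continuous_coset).of_isClosed_subset (isClosed_coset_isSeparated ε) ?_
  rintro _ ⟨g, hg, rfl⟩
  obtain ⟨γ, hγ⟩ := hC g hg
  exact ⟨_, hγ, (coset_eq_iff.mpr ⟨γ, rfl⟩).symm⟩

/-- The row `v` is recovered from `v g` by `g⁻¹`, whose entries are those of `g` up to sign and
position. Some coordinate of `v` has norm at least one and is a sum of two terms, whence `2 * B`. -/
theorem isSeparated_of_norm_lt {B : ℝ} {g : SL2KS K} (hg : ∀ i j, ‖g.1 i j‖ < B) :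
    IsSeparated (2 * B)⁻¹ g := by
  intro v hv
  have hB : 0 < B := (norm_nonneg _).trans_lt (hg 0 0)
  have hdet : g.1 0 0 * g.1 1 1 - g.1 0 1 * g.1 1 0 = 1 := by
    rw [← Matrix.det_fin_two]; exact g.2
  have bound : ∀ i j k, ‖rowMul v g i * g.1 j k‖ ≤ ‖rowMul v g‖ * B := fun i j k =>
    (norm_mul_le _ _).trans (mul_le_mul (norm_le_pi_norm _ i) (hg _ _).le (norm_nonneg _)
      (norm_nonneg _))
  have h0 : tau K (v 0) = rowMul v g 0 * g.1 1 1 - rowMul v g 1 * g.1 1 0 := by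
    simp only [rowMul_apply]; linear_combination (-tau K (v 0)) * hdet
  have h1 : tau K (v 1) = rowMul v g 1 * g.1 0 0 - rowMul v g 0 * g.1 0 1 := by
    simp only [rowMul_apply]; linear_combination (-tau K (v 1)) * hdet
  have key : 1 ≤ 2 * B * ‖rowMul v g‖ := by
    obtain ⟨i, hi⟩ := Function.ne_iff.mp hv
    refine (one_le_norm_tau hi).trans ?_
    have hb : ∀ x y : mixedSpace K, ‖x‖ ≤ ‖rowMul v g‖ * B → ‖y‖ ≤ ‖rowMul v g‖ * B →
        ‖x - y‖ ≤ 2 * B * ‖rowMul v g‖ := fun x y hx hy =>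
      (norm_sub_le _ _).trans (by linarith)
    fin_cases i
    · change ‖tau K (v 0)‖ ≤ _
      rw [h0]
      exact hb _ _ (bound 0 1 1) (bound 1 1 0)
    · change ‖tau K (v 1)‖ ≤ _
      rw [h1]
      exact hb _ _ (bound 1 0 0) (bound 0 0 1)
  rw [inv_le_iff_one_le_mul₀' (by positivity)]
  exact key

/-- Lattices in a compact set of cosets are uniformly separated. -/
theorem exists_isSeparated_of_isCompact {s : Set (cosetSpace K)} (hs : IsCompact s) :
    ∃ ε : ℝ, 0 < ε ∧ ∀ g : SL2KS K, coset g ∈ s → IsSeparated ε g := by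
  let W : ℕ → Set (SL2KS K) := fun n => {g | ∀ i j, ‖g.1 i j‖ < n}
  have hW : ∀ n, IsOpen (W n) := fun n => by
    simp only [W, Set.ofPred_forall]
    refine isOpen_iInter_of_finite fun i => isOpen_iInter_of_finite fun j => ?_
    exact isOpen_lt (continuous_entry i j).norm continuous_const
  have hmono : Monotone fun n => coset '' W n := fun m n hmn =>
    Set.image_mono fun g hg i j => (hg i j).trans_le (Nat.cast_le.mpr hmn)
  obtain ⟨n, hn⟩ := hs.elim_directed_cover (fun n => coset '' W n)
    (fun n => isOpenMap_coset _ (hW n)) (fun y _ => by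
      obtain ⟨g, rfl⟩ := Quotient.exists_rep y
      obtain ⟨n, hn⟩ := exists_nat_gt (∑ i, ∑ j, ‖g.1 i j‖)
      refine Set.mem_iUnion.mpr ⟨n, g, fun i j => lt_of_le_of_lt ?_ hn, rfl⟩
      exact (Finset.single_le_sum (f := fun j => ‖g.1 i j‖) (fun _ _ => norm_nonneg _)
        (Finset.mem_univ j)).trans (Finset.single_le_sum (f := fun i => ∑ j, ‖g.1 i j‖)
        (fun i _ => Finset.sum_nonneg fun _ _ => norm_nonneg _) (Finset.mem_univ i)))
    hmono.directed_le
  -- `n` may be `0` when `s` is empty; `n + 1` keeps the constant positive.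
  refine ⟨(2 * (n + 1 : ℝ))⁻¹, by positivity, fun g hg => ?_⟩
  obtain ⟨h, hh, hhg⟩ := hn hg
  exact (isSeparated_of_norm_lt fun i j => (hh i j).trans (lt_add_one _)).of_coset_eq hhg

/-! ### Dani's correspondence. -/

theorem rowMul_flow (v : Fin 2 → 𝓞 K) (x : mixedSpace K) (t : ℝ) :
    rowMul v (upperUnipotent x * geodesicFlow K t) =
      ![Real.exp (-t) • tau K (v 0), Real.exp t • (tau K (v 0) * x + tau K (v 1))] := by
  rw [rowMul_mul]
  ext1 j
  fin_cases j
  · simp [rowMul, upperUnipotent, geodesicFlow, Matrix.vecMul, dotProduct, Fin.sum_univ_two,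
      Algebra.smul_def, mul_comm]
  · simp [rowMul, upperUnipotent, geodesicFlow, Matrix.vecMul, dotProduct, Fin.sum_univ_two,
      Algebra.smul_def, mul_comm]

theorem norm_exp_smul (t : ℝ) (y : mixedSpace K) : ‖Real.exp t • y‖ = Real.exp t * ‖y‖ := by
  rw [_root_.norm_smul, Real.norm_of_nonneg (Real.exp_pos t).le]

/-- Dani's correspondence between bad approximability and separation along the flow. -/
theorem isBadlyApproximable_iff_isSeparated {x : mixedSpace K} : IsBadlyApproximable x ↔
    ∃ ε : ℝ, 0 < ε ∧ ∀ t : ℝ, 0 ≤ t → IsSeparated ε (upperUnipotent x * geodesicFlow K t) := by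
  simp only [IsBadlyApproximable, maxAbs_eq_norm]
  constructor
  · rintro ⟨c, hc, h⟩
    -- The bound `1` serves rows with `q = 0`, which the flow expands; `√c` serves `q ≠ 0`, where
    -- the coordinate norms have product above `c`.
    refine ⟨min 1 (√c), by positivity, fun t ht v hv => ?_⟩
    rw [rowMul_flow]
    set w : Fin 2 → mixedSpace K :=
      ![Real.exp (-t) • tau K (v 0), Real.exp t • (tau K (v 0) * x + tau K (v 1))]
    have hw0 : Real.exp (-t) * ‖tau K (v 0)‖ ≤ ‖w‖ := by
      rw [← norm_exp_smul]; exact norm_le_pi_norm w 0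
    have hw1 : Real.exp t * ‖tau K (v 0) * x + tau K (v 1)‖ ≤ ‖w‖ := by
      rw [← norm_exp_smul]; exact norm_le_pi_norm w 1
    by_cases hq : v 0 = 0
    · have hp : v 1 ≠ 0 := fun hp => hv (by ext i; fin_cases i <;> simp [hq, hp])
      rw [hq, map_zero, zero_mul, zero_add] at hw1
      refine (min_le_left _ _).trans (le_trans ?_ hw1)
      exact one_le_mul_of_one_le_of_one_le (Real.one_le_exp ht) (one_le_norm_tau hp)
    · refine (min_le_right _ _).trans ?_
      rw [Real.sqrt_le_left (norm_nonneg _)]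
      have := mul_le_mul hw1 hw0 (by positivity) (norm_nonneg _)
      have e : Real.exp t * Real.exp (-t) = 1 := by rw [← Real.exp_add]; simp
      have h2 := h (v 1) (v 0) hq
      calc c ≤ ‖tau K (v 0) * x + tau K (v 1)‖ * ‖tau K (v 0)‖ := h2.le
        _ = (Real.exp t * ‖tau K (v 0) * x + tau K (v 1)‖) *
            (Real.exp (-t) * ‖tau K (v 0)‖) := by
              rw [mul_mul_mul_comm, e, one_mul]
        _ ≤ ‖w‖ ^ 2 := by rw [sq]; exact this
  · rintro ⟨ε, hε, h⟩
    -- At `t = log (2 * A / ρ)` the first coordinate has norm `ρ / 2`, so the second is at least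
    -- `ρ`, giving `A * B ≥ ρ ^ 2 / 2`. Taking `ρ ≤ 1` ensures `t ≥ 0`, and dividing by `3` makes
    -- the inequality strict.
    set ρ := min ε 1
    have hρ : 0 < ρ := by positivity
    refine ⟨ρ ^ 2 / 3, by positivity, fun p q hq => ?_⟩
    have hA := one_le_norm_tau hq
    set A := ‖tau K q‖
    set B := ‖tau K q * x + tau K p‖ with hBdef
    have hexp : 0 < 2 * A / ρ := by positivity
    have ht : 0 ≤ Real.log (2 * A / ρ) := Real.log_nonneg (by
      rw [le_div_iff₀ hρ]; linarith [min_le_right ε 1])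
    have h1 := h _ ht ![q, p] (fun h0 => hq (congrFun h0 0))
    rw [rowMul_flow] at h1
    have h2 : ρ ≤ 2 * A / ρ * B := by
      by_contra! hlt
      have : ‖(![Real.exp (-Real.log (2 * A / ρ)) • tau K q,
          Real.exp (Real.log (2 * A / ρ)) • (tau K q * x + tau K p)] : Fin 2 → mixedSpace K)‖
          < ρ := (pi_norm_lt_iff hρ).mpr fun i => by
        fin_cases i
        · show ‖Real.exp (-Real.log (2 * A / ρ)) • tau K q‖ < ρ
          rw [norm_exp_smul, Real.exp_neg, Real.exp_log hexp]
          show (2 * A / ρ)⁻¹ * A < ρ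
          have : (2 * A / ρ)⁻¹ * A = ρ / 2 := by field_simp
          linarith
        · show ‖Real.exp (Real.log (2 * A / ρ)) • (tau K q * x + tau K p)‖ < ρ
          rw [norm_exp_smul, Real.exp_log hexp]
          exact hlt
      exact absurd (this.trans_le (min_le_left _ _)) (not_lt.mpr h1)
    rw [div_mul_eq_mul_div, le_div_iff₀ hρ] at h2
    nlinarith

end DaniNF

end

theorem proposition3p1 (K : Type*) [Field K] [NumberField K]
    (x : NumberField.mixedEmbedding.mixedSpace K) :
    DaniNF.IsBadlyApproximable x ↔ DaniNF.IsBoundedSubset (DaniNF.trajectory x) := by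
  rw [DaniNF.isBadlyApproximable_iff_isSeparated]
  constructor
  · rintro ⟨ε, hε, h⟩
    refine (DaniNF.isCompact_coset_isSeparated hε).of_isClosed_subset isClosed_closure
      (closure_minimal ?_ (DaniNF.isClosed_coset_isSeparated ε))
    rintro _ ⟨t, ht, rfl⟩
    exact ⟨_, h t ht, rfl⟩
  · intro h
    obtain ⟨ε, hε, hsep⟩ := DaniNF.exists_isSeparated_of_isCompact h
    exact ⟨ε, hε, fun t ht => hsep _ (subset_closure ⟨t, ht, rfl⟩)⟩
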